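/- Let $d,N\ge 1$ be integers and let $p_1,\dots,p_N$ be independent random points, uniformly distributed on the unit sphere $S^{d-1}=\{x\in\mathbb{R}^d:\ \|x\|=1\}$. Let $L_N^d$ be the halving polyhedron of the symmetrized point cloud $\{\pm p_i\}_{1\le i\le N}$, that is, the convex hull of the set of all centroids (arithmetic means) of $N$ distinct members of the family of the $2N$ points $p_1,\dots,p_N,-p_1,\dots,-p_N$ (points are distinguished by their label; for $d\ge 2$ the $2N$ points are almost surely pairwise distinct). Let $m_d:=\mathbb{E}|X\cdot u|$, where $X$ is uniformly distributed on $S^{d-1}$ and $u$ is an arbitrary unit vector (the value does not depend on $u$). Let $d_H$ denote the Hausdorff distance and $B(0,1)$ the closed Euclidean unit ball of $\mathbb{R}^d$. For every $\kappa>0$ there is a constant $C_\kappa$, depending only on $\kappa$, such that for all $\eta>0$ and all integers $d,N\ge 1$ with $$d\ge \frac{1}{\eta^2}\qquad\text{and}\qquad N\ge \frac{d}{\eta^2}\,(\log d+C_\kappa),$$ the inequality $$d_H\Big(\frac{1}{m_d}L_N^d,\ B(0,1)\Big)\le \eta$$ holds with probability at least $1-\exp(-\kappa d)$. -/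

import Mathlib

open MeasureTheory ProbabilityTheory
open scoped Pointwise

/-- The unit sphere of `ℝ^d`. -/
abbrev UnitSphere (d : ℕ) : Type :=
  Metric.sphere (0 : EuclideanSpace ℝ (Fin d)) 1

/-- The uniform distribution on the unit sphere of `ℝ^d`: the surface measure, normalized to have
total mass one (for `d ≥ 1`). -/
noncomputable def uniformSphere (d : ℕ) : Measure (UnitSphere d) :=
  ((volume : Measure (EuclideanSpace ℝ (Fin d))).toSphere Set.univ)⁻¹ •
    (volume : Measure (EuclideanSpace ℝ (Fin d))).toSphere

/-- The mean of `|X · u|` where `X` is uniformly distributed on the unit sphere. -/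
noncomputable def meanAbsInner {d : ℕ} (u : UnitSphere d) : ℝ :=
  ∫ x : UnitSphere d, |inner ℝ (x : EuclideanSpace ℝ (Fin d)) (u : EuclideanSpace ℝ (Fin d))|
    ∂(uniformSphere d)

/-- The `k`-set polyhedron of a point cloud, given as an indexed family: the convex hull of the
centroids of `k` distinct members of the family. -/
def kSetPolyhedron {ι V : Type*} [AddCommGroup V] [Module ℝ V] (k : ℕ) (p : ι → V) : Set V :=
  convexHull ℝ {x | ∃ s : Finset ι, s.card = k ∧ x = (k : ℝ)⁻¹ • ∑ i ∈ s, p i}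

/-- The symmetrization of the point cloud `p₁, …, p_N`: the `2N` points `±p_i`. -/
def symmetrization {N : ℕ} {V : Type*} [AddCommGroup V] (p : Fin N → V) :
    Fin N ⊕ Fin N → V :=
  Sum.elim p (fun i => -p i)

/-- The halving polyhedron of the symmetrization of the point cloud `p₁, …, p_N`. -/
def halvingPolyhedron {N : ℕ} {V : Type*} [AddCommGroup V] [Module ℝ V] (p : Fin N → V) :
    Set V :=
  kSetPolyhedron N (symmetrization p)

/-- If the points of the cloud are pairwise distinct, the `k`-set polyhedron is the convex hull of
the centroids of the `k`-element subsets of the underlying point set. -/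
theorem kSetPolyhedron_of_injective {ι V : Type*} [AddCommGroup V] [Module ℝ V] (k : ℕ)
    (p : ι → V) (hp : Function.Injective p) :
    kSetPolyhedron k p = convexHull ℝ {x | ∃ t : Finset V, (t : Set V) ⊆ Set.range p ∧
      t.card = k ∧ x = (k : ℝ)⁻¹ • ∑ v ∈ t, v} := by
  classical
  unfold kSetPolyhedron
  congr 1
  ext x
  constructor
  · rintro ⟨s, hs, rfl⟩
    refine ⟨s.image p, ?_, ?_, ?_⟩
    · intro v hv
      obtain ⟨i, -, rfl⟩ := Finset.mem_image.1 (Finset.mem_coe.1 hv)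
      exact ⟨i, rfl⟩
    · rw [Finset.card_image_of_injective s hp, hs]
    · rw [Finset.sum_image (fun a _ b _ h => hp h)]
  · rintro ⟨t, ht, hk, rfl⟩
    refine ⟨t.preimage p hp.injOn, ?_, ?_⟩
    · rw [← hk, ← Finset.card_image_of_injective _ hp, Finset.image_preimage]
      congr 1
      exact Finset.filter_true_of_mem (fun v hv => ht hv)
    · rw [Finset.sum_preimage p t hp.injOn (fun v => v)
        (fun v hv hv' => absurd (ht hv) hv')]

/-- The underlying set of the symmetrization of a point set `P` is `P ∪ (-P)`. -/
theorem range_symmetrization {N : ℕ} {V : Type*} [AddCommGroup V] (p : Fin N → V) :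
    Set.range (symmetrization p) = Set.range p ∪ -Set.range p := by
  ext x
  simp [symmetrization, neg_eq_iff_eq_neg]

/-! For a symmetrized cloud, choosing the better of `p i` and `-p i` in each pair shows that the
support function of the halving polyhedron is `meanAbs p u`, the empirical mean of `|⟪p i, u⟫|`. Its
expectation on unit vectors is `m = meanAbsInner u`, so the Hausdorff bound reduces to `|meanAbs p u
- m| ≤ η * m` uniformly over unit `u` (`hausdorffDist_halvingPolyhedron_le`).

The increment `|⟪x, v⟫| - |⟪x, w⟫|` is dominated by `|⟪x, v - w⟫|`, hence is subgaussian with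
parameter `4‖v - w‖² / d` after centring (`hasSubgaussianMGF_uniformSphere`). Since `m²` is at least
`1 / (320 d)`, a deviation of order `η * m` has probability about `exp (-c N η² / ‖v - w‖²)`.

Uniformity comes from two nets. A net fine enough for `η` has up to `(17 d) ^ d` points, and a
direct union bound would put a large constant before `log d`. Instead, a coarse net of fixed mesh
has only `513 ^ d` points and costs no `log d`; the increments from fine to coarse points are short,
and their smaller variance pays for `log d` with coefficient one. `abs_meanAbs_sub_le_of_nets`
passes from the nets to the whole sphere. -/

/-! ### Rotation invariance of the uniform measure -/

/-- A linear isometry acts on the unit sphere. -/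
noncomputable def sphereMap {d : ℕ} (f : EuclideanSpace ℝ (Fin d) ≃ₗᵢ[ℝ] EuclideanSpace ℝ (Fin d))
    (x : UnitSphere d) : UnitSphere d :=
  ⟨f x, by simp⟩

lemma continuous_sphereMap {d : ℕ}
    (f : EuclideanSpace ℝ (Fin d) ≃ₗᵢ[ℝ] EuclideanSpace ℝ (Fin d)) :
    Continuous (sphereMap f) :=
  (f.continuous.comp continuous_subtype_val).subtype_mk _

/-- The surface measure of a set is a multiple of the volume of the cone over it, and a linear
isometry preserves volume and commutes with forming cones. -/
lemma measurePreserving_sphereMap {d : ℕ}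
    (f : EuclideanSpace ℝ (Fin d) ≃ₗᵢ[ℝ] EuclideanSpace ℝ (Fin d)) :
    MeasurePreserving (sphereMap f) (uniformSphere d) (uniformSphere d) := by
  have hm : Measurable (sphereMap f) := (continuous_sphereMap f).measurable
  refine ⟨hm, ?_⟩
  ext s hs
  rw [Measure.map_apply hm hs]
  simp only [uniformSphere, Measure.smul_apply]
  congr 1
  rw [Measure.toSphere_apply' _ (hm hs), Measure.toSphere_apply' _ hs]
  congr 1
  have hpre : Set.Ioo (0 : ℝ) 1 • ((↑) '' (sphereMap f ⁻¹' s) : Set (EuclideanSpace ℝ (Fin d))) =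
      f.toHomeomorph.toMeasurableEquiv ⁻¹' (Set.Ioo (0 : ℝ) 1 • ((↑) '' s)) := by
    ext x
    simp only [Set.mem_smul, Set.mem_preimage, Set.mem_image]
    constructor
    · rintro ⟨r, hr, _, ⟨y, hy, rfl⟩, rfl⟩
      exact ⟨r, hr, _, ⟨_, hy, rfl⟩, (map_smul f r _).symm⟩
    · rintro ⟨r, hr, _, ⟨z, hz, rfl⟩, hx⟩
      refine ⟨r, hr, f.symm z, ⟨sphereMap f.symm z, ?_, rfl⟩, ?_⟩
      · have : sphereMap f (sphereMap f.symm z) = z := by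
          ext1
          simp [sphereMap]
        simpa [this] using hz
      · apply f.injective
        rw [map_smul, f.apply_symm_apply]
        exact hx
  rw [hpre]
  exact f.measurePreserving.measure_preimage_equiv (f := f.toHomeomorph.toMeasurableEquiv) _

lemma isProbabilityMeasure_uniformSphere {d : ℕ} (hd : 1 ≤ d) :
    IsProbabilityMeasure (uniformSphere d) := by
  have : Nonempty (Fin d) := ⟨⟨0, hd⟩⟩
  refine ⟨?_⟩
  simp only [uniformSphere, Measure.smul_apply, smul_eq_mul]
  refine ENNReal.inv_mul_cancel ?_ (measure_ne_top _ _)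
  rw [Measure.measure_univ_ne_zero]
  exact Measure.toSphere_ne_zero _

instance {d : ℕ} : IsFiniteMeasure (uniformSphere d) := by
  -- In dimension zero the sphere is empty and the measure vanishes.
  rcases Nat.eq_zero_or_pos d with rfl | hd
  · have : IsEmpty (UnitSphere 0) := ⟨fun x => by
      have := x.2
      rw [mem_sphere_zero_iff_norm, Subsingleton.elim (x : EuclideanSpace ℝ (Fin 0)) 0] at this
      simp at this⟩
    refine ⟨?_⟩
    rw [Measure.eq_zero_of_isEmpty (uniformSphere 0)]
    simp
  · have := isProbabilityMeasure_uniformSphere hd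
    infer_instance

lemma integrable_uniformSphere_of_continuous {d : ℕ} {f : UnitSphere d → ℝ} (hf : Continuous f) :
    Integrable f (uniformSphere d) :=
  hf.integrable_of_hasCompactSupport (HasCompactSupport.of_compactSpace f)

lemma exists_linearIsometryEquiv_map_eq {E : Type*} [NormedAddCommGroup E] [InnerProductSpace ℝ E]
    {v w : E} (h : ‖v‖ = ‖w‖) : ∃ f : E ≃ₗᵢ[ℝ] E, f v = w :=
  ⟨_, Submodule.reflection_sub h⟩

lemma integral_uniformSphere_comp_sphereMap {d : ℕ}
    (f : EuclideanSpace ℝ (Fin d) ≃ₗᵢ[ℝ] EuclideanSpace ℝ (Fin d)) {g : UnitSphere d → ℝ}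
    (hg : Continuous g) :
    ∫ x, g (sphereMap f x) ∂(uniformSphere d) = ∫ x, g x ∂(uniformSphere d) := by
  have h := measurePreserving_sphereMap f
  conv_rhs => rw [← h.map_eq]
  rw [integral_map h.measurable.aemeasurable hg.aestronglyMeasurable]

/-- The law of `⟪X, v⟫` under the uniform distribution depends only on the norm of `v`. -/
lemma integral_uniformSphere_inner_eq {d : ℕ} {v w : EuclideanSpace ℝ (Fin d)} (h : ‖v‖ = ‖w‖)
    {φ : ℝ → ℝ} (hφ : Continuous φ) :
    ∫ x : UnitSphere d, φ (inner ℝ (x : EuclideanSpace ℝ (Fin d)) v) ∂(uniformSphere d) =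
      ∫ x : UnitSphere d, φ (inner ℝ (x : EuclideanSpace ℝ (Fin d)) w) ∂(uniformSphere d) := by
  obtain ⟨f, rfl⟩ := exists_linearIsometryEquiv_map_eq h
  rw [← integral_uniformSphere_comp_sphereMap f
    (g := fun x => φ (inner ℝ (x : EuclideanSpace ℝ (Fin d)) (f v))) (by fun_prop)]
  simp [sphereMap]

/-! ### Subgaussian estimates on the sphere -/

/-- The reflection in the coordinate hyperplanes selected by `s`. -/
noncomputable def signIsometry {d : ℕ} (s : Fin d → Bool) :
    EuclideanSpace ℝ (Fin d) ≃ₗᵢ[ℝ] EuclideanSpace ℝ (Fin d) :=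
  LinearIsometryEquiv.piLpCongrRight 2
    (fun i => if s i then LinearIsometryEquiv.refl ℝ ℝ else LinearIsometryEquiv.neg ℝ)

lemma signIsometry_apply {d : ℕ} (s : Fin d → Bool) (x : EuclideanSpace ℝ (Fin d)) (i : Fin d) :
    signIsometry s x i = (if s i then 1 else -1) * x i := by
  cases h : s i <;> simp [signIsometry, h]

lemma sum_exp_sign_eq_prod_cosh {d : ℕ} (a : Fin d → ℝ) :
    ∑ s : Fin d → Bool, Real.exp (∑ i, (if s i then 1 else -1) * a i) =
      ∏ i, (2 * Real.cosh (a i)) := by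
  have h : ∀ i, 2 * Real.cosh (a i) =
      ∑ b : Bool, Real.exp ((if b then 1 else -1) * a i) := by
    intro i
    rw [Real.cosh_eq]
    simp
    ring
  simp_rw [h, Real.exp_sum]
  rw [Finset.prod_univ_sum, Fintype.piFinset_univ]

lemma sum_sq_coord_sphere {d : ℕ} (x : UnitSphere d) :
    ∑ i, (x : EuclideanSpace ℝ (Fin d)) i ^ 2 = 1 := by
  have h := EuclideanSpace.norm_sq_eq (x : EuclideanSpace ℝ (Fin d))
  rw [norm_eq_of_mem_sphere] at h
  simpa using h.symm

/-- The linear functionals of a uniform random point of the sphere are subgaussian. -/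
lemma integral_exp_inner_uniformSphere_le {d : ℕ} (hd : 1 ≤ d) (w : EuclideanSpace ℝ (Fin d)) :
    ∫ x : UnitSphere d, Real.exp (inner ℝ (x : EuclideanSpace ℝ (Fin d)) w) ∂(uniformSphere d) ≤
      Real.exp (‖w‖ ^ 2 / (2 * d)) := by
  have := isProbabilityMeasure_uniformSphere hd
  have hd0 : (0 : ℝ) < d := by exact_mod_cast hd
  -- By rotation invariance `w` may be replaced by a vector with equal coordinates. Averaging over
  -- sign flips then gives a product of `cosh (x i * a)`, and `cosh y ≤ exp (y² / 2)` together with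
  -- `∑ x i ² = 1` makes the bound independent of `x`.
  set a : ℝ := ‖w‖ / √d with ha
  set v : EuclideanSpace ℝ (Fin d) := WithLp.toLp 2 (fun _ => a) with hv
  have ha2 : a ^ 2 = ‖w‖ ^ 2 / d := by rw [ha, div_pow, Real.sq_sqrt hd0.le]
  have hnorm : ‖w‖ = ‖v‖ := by
    rw [← sq_eq_sq₀ (norm_nonneg _) (norm_nonneg _), EuclideanSpace.norm_sq_eq v]
    simp [hv, ha2]
    field_simp
  rw [integral_uniformSphere_inner_eq hnorm Real.continuous_exp]
  have hinner : ∀ x : EuclideanSpace ℝ (Fin d), inner ℝ x v = ∑ i, x i * a := by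
    intro x
    simp [PiLp.inner_apply, hv, mul_comm]
  have hflip : ∀ s : Fin d → Bool,
      ∫ x : UnitSphere d, Real.exp (∑ i, (if s i then 1 else -1) *
        ((x : EuclideanSpace ℝ (Fin d)) i * a)) ∂(uniformSphere d) =
      ∫ x : UnitSphere d, Real.exp (inner ℝ (x : EuclideanSpace ℝ (Fin d)) v)
        ∂(uniformSphere d) := by
    intro s
    rw [← integral_uniformSphere_comp_sphereMap (signIsometry s)
      (g := fun x => Real.exp (inner ℝ (x : EuclideanSpace ℝ (Fin d)) v)) (by fun_prop)]
    congr 1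
    ext x
    rw [hinner]
    simp only [sphereMap, signIsometry_apply, mul_assoc]
  have hcont : ∀ s : Fin d → Bool, Continuous (fun x : UnitSphere d =>
      Real.exp (∑ i, (if s i then 1 else -1) * ((x : EuclideanSpace ℝ (Fin d)) i * a))) := by
    intro s
    fun_prop
  have hsum : (2 : ℝ) ^ d * ∫ x : UnitSphere d,
      Real.exp (inner ℝ (x : EuclideanSpace ℝ (Fin d)) v) ∂(uniformSphere d) =
      ∫ x : UnitSphere d, ∏ i, (2 * Real.cosh ((x : EuclideanSpace ℝ (Fin d)) i * a))
        ∂(uniformSphere d) := by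
    simp_rw [← sum_exp_sign_eq_prod_cosh]
    rw [integral_finsetSum _ (fun s _ => integrable_uniformSphere_of_continuous (hcont s))]
    simp_rw [hflip]
    simp
  have hle : ∫ x : UnitSphere d, ∏ i, (2 * Real.cosh ((x : EuclideanSpace ℝ (Fin d)) i * a))
      ∂(uniformSphere d) ≤ ∫ _ : UnitSphere d, 2 ^ d * Real.exp (‖w‖ ^ 2 / (2 * d))
        ∂(uniformSphere d) := by
    refine integral_mono (integrable_uniformSphere_of_continuous ?_) (integrable_const _) ?_
    · have := Real.continuous_cosh
      fun_prop
    · intro x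
      calc ∏ i, (2 * Real.cosh ((x : EuclideanSpace ℝ (Fin d)) i * a))
          ≤ ∏ i, (2 * Real.exp (((x : EuclideanSpace ℝ (Fin d)) i * a) ^ 2 / 2)) := by
            refine Finset.prod_le_prod (fun i _ => by positivity) (fun i _ => ?_)
            gcongr
            exact Real.cosh_le_exp_half_sq _
        _ = 2 ^ d * Real.exp (‖w‖ ^ 2 / (2 * d)) := by
            rw [Finset.prod_mul_distrib, ← Real.exp_sum]
            simp only [Finset.prod_const, Finset.card_univ, Fintype.card_fin]
            rw [← Finset.sum_div]
            simp_rw [mul_pow]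
            rw [← Finset.sum_mul, sum_sq_coord_sphere, ha2]
            congr 2
            field_simp
  rw [← hsum, integral_const] at hle
  simp only [probReal_univ, one_smul] at hle
  exact le_of_mul_le_mul_left hle (by positivity)

lemma integral_cosh_inner_uniformSphere_le {d : ℕ} (hd : 1 ≤ d) (w : EuclideanSpace ℝ (Fin d))
    (s : ℝ) :
    ∫ x : UnitSphere d, Real.cosh (s * inner ℝ (x : EuclideanSpace ℝ (Fin d)) w)
      ∂(uniformSphere d) ≤ Real.exp (s ^ 2 * ‖w‖ ^ 2 / (2 * d)) := by
  have h1 := integral_exp_inner_uniformSphere_le hd (s • w)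
  have h2 := integral_exp_inner_uniformSphere_le hd (-(s • w))
  rw [norm_neg] at h2
  rw [norm_smul, mul_pow, Real.norm_eq_abs, sq_abs] at h1 h2
  simp_rw [Real.cosh_eq]
  rw [integral_div, integral_add (integrable_uniformSphere_of_continuous (by fun_prop))
    (integrable_uniformSphere_of_continuous (by fun_prop))]
  simp only [inner_neg_right, inner_smul_right] at h1 h2
  linarith

/-- A continuous function dominated by a linear functional is subgaussian after centring. -/
lemma hasSubgaussianMGF_uniformSphere {d : ℕ} (hd : 1 ≤ d) (w : EuclideanSpace ℝ (Fin d))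
    {Y : UnitSphere d → ℝ} (hY : Continuous Y)
    (hYw : ∀ x : UnitSphere d, |Y x| ≤ |inner ℝ (x : EuclideanSpace ℝ (Fin d)) w|) :
    HasSubgaussianMGF (fun x => Y x - ∫ y, Y y ∂(uniformSphere d))
      (4 * ‖w‖₊ ^ 2 / d) (uniformSphere d) := by
  have := isProbabilityMeasure_uniformSphere hd
  refine ⟨fun t => integrable_uniformSphere_of_continuous (by fun_prop), fun t => ?_⟩
  set e := ∫ y, Y y ∂(uniformSphere d) with he
  have icosh : ∀ s, Integrable (fun x => Real.cosh (s * Y x)) (uniformSphere d) := fun s =>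
    integrable_uniformSphere_of_continuous (Real.continuous_cosh.comp (by fun_prop))
  -- Symmetrization: Jensen replaces the centring factor by `B`, and `A * B ≤ ((A + B) / 2)² = D²`.
  -- Only the even function `cosh` remains, so the bound on `|Y|` suffices.
  set A := ∫ x, Real.exp (t * Y x) ∂(uniformSphere d) with hA
  set B := ∫ x, Real.exp (-(t * Y x)) ∂(uniformSphere d) with hB
  set D := ∫ x, Real.cosh (t * Y x) ∂(uniformSphere d) with hD
  have hmgf : mgf (fun x => Y x - e) (uniformSphere d) t = A * Real.exp (-(t * e)) := by
    simp only [mgf]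
    rw [hA, ← integral_mul_const]
    congr 1
    ext x
    rw [← Real.exp_add]
    congr 1
    ring
  have hjensen : Real.exp (-(t * e)) ≤ B := by
    have h1 : ∫ x, (-(t * Y x) + t * e + 1) ∂(uniformSphere d) ≤
        ∫ x, Real.exp (-(t * Y x)) * Real.exp (t * e) ∂(uniformSphere d) := by
      refine integral_mono (integrable_uniformSphere_of_continuous (by fun_prop))
        (integrable_uniformSphere_of_continuous (by fun_prop)) (fun x => ?_)
      simp only [← Real.exp_add]
      exact Real.add_one_le_exp _
    rw [integral_mul_const, integral_add (integrable_uniformSphere_of_continuous (by fun_prop))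
      (integrable_const _), integral_add (integrable_uniformSphere_of_continuous (by fun_prop))
      (integrable_const _), integral_neg, integral_const_mul] at h1
    simp only [integral_const, probReal_univ, one_smul, ← he, ← hB] at h1
    rw [Real.exp_neg, inv_le_iff_one_le_mul₀ (Real.exp_pos _)]
    linarith
  have hAB : A + B = 2 * D := by
    rw [hA, hB, hD, ← integral_add (integrable_uniformSphere_of_continuous (by fun_prop))
      (integrable_uniformSphere_of_continuous (by fun_prop)), ← integral_const_mul]
    congr 1
    ext x
    rw [Real.cosh_eq]
    ring
  have hD1 : 1 ≤ D := by
    have : ∫ _ : UnitSphere d, (1 : ℝ) ∂(uniformSphere d) ≤ D :=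
      integral_mono (integrable_const _) (icosh t) (fun x => Real.one_le_cosh _)
    simpa using this
  -- Integrating `cosh² ≥ 2 D cosh - D²` with the double-angle formula gives `2 D² - 1` as a lower
  -- bound, which is at least `D²` because `D ≥ 1`.
  have hDsq : D ^ 2 ≤ ∫ x, Real.cosh (2 * t * Y x) ∂(uniformSphere d) := by
    have h2 : ∫ x, (4 * D * Real.cosh (t * Y x) - 2 * D ^ 2 - 1) ∂(uniformSphere d) ≤
        ∫ x, Real.cosh (2 * t * Y x) ∂(uniformSphere d) := by
      refine integral_mono ((((icosh t).const_mul _).sub (integrable_const _)).sub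
        (integrable_const _)) (icosh _) (fun x => ?_)
      have h3 : Real.cosh (2 * t * Y x) = 2 * Real.cosh (t * Y x) ^ 2 - 1 := by
        rw [mul_assoc, Real.cosh_two_mul, Real.sinh_sq]
        ring
      simp only [h3]
      nlinarith [sq_nonneg (Real.cosh (t * Y x) - D)]
    have i1 : Integrable (fun x => 4 * D * Real.cosh (t * Y x)) (uniformSphere d) :=
      (icosh t).const_mul _
    have i2 : Integrable (fun x => 4 * D * Real.cosh (t * Y x) - 2 * D ^ 2) (uniformSphere d) :=
      i1.sub (integrable_const _)
    rw [integral_sub i2 (integrable_const _), integral_sub i1 (integrable_const _),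
      integral_const_mul] at h2
    simp only [integral_const, probReal_univ, one_smul, ← hD] at h2
    nlinarith
  have hdom : ∫ x, Real.cosh (2 * t * Y x) ∂(uniformSphere d) ≤
      ∫ x : UnitSphere d, Real.cosh (2 * t * inner ℝ (x : EuclideanSpace ℝ (Fin d)) w)
        ∂(uniformSphere d) := by
    refine integral_mono (icosh _) (integrable_uniformSphere_of_continuous
      (Real.continuous_cosh.comp (by fun_prop))) (fun x => ?_)
    simp only [Real.cosh_le_cosh, abs_mul]
    exact mul_le_mul_of_nonneg_left (hYw x) (by positivity)
  have hfin := integral_cosh_inner_uniformSphere_le hd w (2 * t)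
  have hA0 : 0 ≤ A := integral_nonneg (fun x => (Real.exp_pos _).le)
  calc mgf (fun x => Y x - e) (uniformSphere d) t = A * Real.exp (-(t * e)) := hmgf
    _ ≤ A * B := by gcongr
    _ ≤ D ^ 2 := by nlinarith [sq_nonneg (A - B)]
    _ ≤ Real.exp ((2 * t) ^ 2 * ‖w‖ ^ 2 / (2 * d)) := hDsq.trans (hdom.trans hfin)
    _ = _ := by
      congr 1
      push_cast
      ring

/-! ### Moments and the lower bound on the mean -/

lemma integral_sq_inner_uniformSphere {d : ℕ} (hd : 1 ≤ d) (u : UnitSphere d) :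
    ∫ x : UnitSphere d, (inner ℝ (x : EuclideanSpace ℝ (Fin d))
      (u : EuclideanSpace ℝ (Fin d))) ^ 2 ∂(uniformSphere d) = 1 / d := by
  have := isProbabilityMeasure_uniformSphere hd
  have hd0 : (0 : ℝ) < d := by exact_mod_cast hd
  have h : ∀ i : Fin d, ∫ x : UnitSphere d, ((x : EuclideanSpace ℝ (Fin d)) i) ^ 2
      ∂(uniformSphere d) = ∫ x : UnitSphere d, (inner ℝ (x : EuclideanSpace ℝ (Fin d))
      (u : EuclideanSpace ℝ (Fin d))) ^ 2 ∂(uniformSphere d) := by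
    intro i
    rw [← integral_uniformSphere_inner_eq (v := EuclideanSpace.single i (1 : ℝ)) (by simp)
      (continuous_pow 2)]
    simp [EuclideanSpace.inner_single_right]
  have hsum : ∑ i : Fin d, ∫ x : UnitSphere d, ((x : EuclideanSpace ℝ (Fin d)) i) ^ 2
      ∂(uniformSphere d) = 1 := by
    rw [← integral_finsetSum _
      (fun i _ => integrable_uniformSphere_of_continuous (by fun_prop))]
    simp_rw [sum_sq_coord_sphere]
    simp
  simp_rw [h] at hsum
  simp at hsum
  field_simp
  linarith

lemma pow_four_le_cosh (x : ℝ) : x ^ 4 ≤ 24 * Real.cosh x := by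
  have h := le_hasSum (Real.hasSum_cosh x) 2 (fun n _ => by
    rw [pow_mul]
    positivity)
  norm_num [Nat.factorial] at h
  linarith

/-- Apply `y⁴ ≤ 24 cosh y` at scale `√d`, where the mean of `cosh` is at most `exp (1/2) ≤ 5/3`;
then `24 * 5/3 = 40`. -/
lemma integral_pow_four_inner_uniformSphere_le {d : ℕ} (hd : 1 ≤ d) (u : UnitSphere d) :
    ∫ x : UnitSphere d, (inner ℝ (x : EuclideanSpace ℝ (Fin d))
      (u : EuclideanSpace ℝ (Fin d))) ^ 4 ∂(uniformSphere d) ≤ 40 / d ^ 2 := by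
  have hd0 : (0 : ℝ) < d := by exact_mod_cast hd
  have h := integral_cosh_inner_uniformSphere_le hd (u : EuclideanSpace ℝ (Fin d)) √d
  rw [norm_eq_of_mem_sphere, Real.sq_sqrt hd0.le] at h
  have hexp : Real.exp (d * 1 ^ 2 / (2 * d)) ≤ 5 / 3 := by
    have h1 : ((d : ℝ) * 1 ^ 2 / (2 * d)) = 1 / 2 := by field_simp
    rw [h1, Real.exp_half, Real.sqrt_le_left (by norm_num)]
    linarith [Real.exp_one_lt_d9]
  have hle : ∫ x : UnitSphere d, (d : ℝ) ^ 2 * (inner ℝ (x : EuclideanSpace ℝ (Fin d))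
      (u : EuclideanSpace ℝ (Fin d))) ^ 4 ∂(uniformSphere d) ≤
      ∫ x : UnitSphere d, 24 * Real.cosh (√d * inner ℝ (x : EuclideanSpace ℝ (Fin d))
        (u : EuclideanSpace ℝ (Fin d))) ∂(uniformSphere d) := by
    refine integral_mono (integrable_uniformSphere_of_continuous (by fun_prop))
      (integrable_uniformSphere_of_continuous
        ((Real.continuous_cosh.comp (by fun_prop)).const_mul _)) (fun x => ?_)
    refine le_trans (le_of_eq ?_) (pow_four_le_cosh _)
    rw [mul_pow, show √(d : ℝ) ^ 4 = (√(d : ℝ) ^ 2) ^ 2 by ring, Real.sq_sqrt hd0.le]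
  rw [integral_const_mul, integral_const_mul] at hle
  rw [le_div_iff₀ (by positivity)]
  linarith

lemma meanAbsInner_nonneg {d : ℕ} (u : UnitSphere d) : 0 ≤ meanAbsInner u :=
  integral_nonneg (fun _ => abs_nonneg _)

/-- The first moment is bounded below by the second and fourth, by integrating `a² y² - y⁴ ≤ a³
|y|`. -/
lemma meanAbsInner_sq_ge {d : ℕ} (hd : 1 ≤ d) (u : UnitSphere d) :
    1 / (320 * d) ≤ meanAbsInner u ^ 2 := by
  have hd0 : (0 : ℝ) < d := by exact_mod_cast hd
  -- This makes `a²` times the second moment equal to twice the bound `40 / d²` on the fourth.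
  set a : ℝ := √(80 / d) with ha
  have ha2 : a ^ 2 = 80 / d := Real.sq_sqrt (by positivity)
  have ha0 : 0 < a := Real.sqrt_pos.2 (by positivity)
  have hpt : ∀ y : ℝ, a ^ 2 * y ^ 2 - y ^ 4 ≤ a ^ 3 * |y| := by
    intro y
    rw [← sq_abs y, show y ^ 4 = |y| ^ 4 by rw [pow_abs, abs_of_nonneg (by positivity)]]
    have hz := abs_nonneg y
    set z := |y|
    rcases le_total z a with h | h
    · have : 0 ≤ a ^ 2 * z * (a - z) := mul_nonneg (by positivity) (by linarith)
      nlinarith [pow_nonneg hz 4]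
    · have : 0 ≤ z ^ 2 * ((z - a) * (z + a)) :=
        mul_nonneg (by positivity) (mul_nonneg (by linarith) (by linarith))
      have : 0 ≤ a ^ 3 * z := by positivity
      nlinarith
  have hint : ∫ x : UnitSphere d, (a ^ 2 * (inner ℝ (x : EuclideanSpace ℝ (Fin d))
      (u : EuclideanSpace ℝ (Fin d))) ^ 2 - (inner ℝ (x : EuclideanSpace ℝ (Fin d))
      (u : EuclideanSpace ℝ (Fin d))) ^ 4) ∂(uniformSphere d) ≤
      ∫ x : UnitSphere d, a ^ 3 * |inner ℝ (x : EuclideanSpace ℝ (Fin d))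
        (u : EuclideanSpace ℝ (Fin d))| ∂(uniformSphere d) :=
    integral_mono (integrable_uniformSphere_of_continuous (by fun_prop))
      (integrable_uniformSphere_of_continuous (by fun_prop)) (fun x => hpt _)
  rw [integral_sub (integrable_uniformSphere_of_continuous (by fun_prop))
    (integrable_uniformSphere_of_continuous (by fun_prop)), integral_const_mul,
    integral_const_mul, integral_sq_inner_uniformSphere hd] at hint
  have h4 := integral_pow_four_inner_uniformSphere_le hd u
  have hm : 40 / d ^ 2 ≤ a ^ 3 * meanAbsInner u := by
    have : a ^ 2 * (1 / d) = 80 / (d : ℝ) ^ 2 := by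
      rw [ha2]
      field_simp
    have : (80 : ℝ) / d ^ 2 - 40 / d ^ 2 = 40 / d ^ 2 := by ring
    unfold meanAbsInner
    linarith
  have hsq : (40 / (d : ℝ) ^ 2) ^ 2 ≤ (a ^ 3 * meanAbsInner u) ^ 2 := by gcongr
  rw [mul_pow, show (a ^ 3) ^ 2 = (a ^ 2) ^ 3 by ring, ha2] at hsq
  rw [div_le_iff₀ (by positivity)]
  field_simp at hsq
  linarith

lemma meanAbsInner_pos {d : ℕ} (hd : 1 ≤ d) (u : UnitSphere d) : 0 < meanAbsInner u := by
  have hd0 : (0 : ℝ) < d := by exact_mod_cast hd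
  refine (meanAbsInner_nonneg u).lt_of_ne' fun h => ?_
  have := meanAbsInner_sq_ge hd u
  rw [h] at this
  have : 0 < 1 / (320 * (d : ℝ)) := by positivity
  linarith

lemma integral_abs_inner_uniformSphere {d : ℕ} (u : UnitSphere d)
    (v : EuclideanSpace ℝ (Fin d)) :
    ∫ x : UnitSphere d, |inner ℝ (x : EuclideanSpace ℝ (Fin d)) v| ∂(uniformSphere d) =
      meanAbsInner u * ‖v‖ := by
  rw [integral_uniformSphere_inner_eq (w := ‖v‖ • (u : EuclideanSpace ℝ (Fin d)))
    (by simp [norm_smul]) continuous_abs]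
  simp_rw [inner_smul_right, abs_mul, abs_norm]
  rw [integral_const_mul, meanAbsInner, mul_comm]

/-! ### Nets of the unit ball -/

/-- The volume bound for separated subsets of the unit ball. -/
lemma card_le_of_pairwise_dist_ge {d : ℕ} {ε : ℝ} (hε : 0 < ε)
    (T : Finset (EuclideanSpace ℝ (Fin d))) (hT : ∀ x ∈ T, ‖x‖ ≤ 1)
    (hsep : (T : Set (EuclideanSpace ℝ (Fin d))).Pairwise fun x y => ε ≤ dist x y) :
    (T.card : ℝ) ≤ (1 + 2 / ε) ^ d := by
  set μ : Measure (EuclideanSpace ℝ (Fin d)) := volume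
  have hdisj : (T : Set (EuclideanSpace ℝ (Fin d))).PairwiseDisjoint
      fun x => Metric.ball x (ε / 2) := by
    intro x hx y hy hxy
    exact Metric.ball_disjoint_ball (by linarith [hsep hx hy hxy])
  have hsub : (⋃ x ∈ T, Metric.ball x (ε / 2)) ⊆ Metric.ball 0 (1 + ε / 2) := by
    refine Set.iUnion₂_subset fun x hx => Metric.ball_subset_ball' ?_
    rw [dist_zero_right]
    linarith [hT x hx]
  have hμ := measure_mono (μ := μ) hsub
  rw [measure_biUnion_finset hdisj (fun x _ => measurableSet_ball)] at hμ
  simp only [Measure.addHaar_ball_of_pos μ _ (half_pos hε),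
    Measure.addHaar_ball_of_pos μ (0 : EuclideanSpace ℝ (Fin d)) (show 0 < 1 + ε / 2 by linarith),
    Finset.sum_const, finrank_euclideanSpace_fin, nsmul_eq_mul] at hμ
  rw [← mul_assoc, ENNReal.mul_le_mul_iff_left (Metric.measure_ball_pos μ _ one_pos).ne'
    measure_ball_lt_top.ne, ← ENNReal.ofReal_natCast, ← ENNReal.ofReal_mul (by positivity),
    ENNReal.ofReal_le_ofReal_iff (by positivity), ← le_div_iff₀ (by positivity), ← div_pow] at hμ
  refine hμ.trans (le_of_eq ?_)
  congr 1
  field_simp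
  ring

/-- An `ε`-net of the unit ball. -/
lemma exists_finset_net {d : ℕ} {ε : ℝ} (hε : 0 < ε) :
    ∃ T : Finset (EuclideanSpace ℝ (Fin d)), (∀ x ∈ T, ‖x‖ ≤ 1) ∧
      (T.card : ℝ) ≤ (1 + 2 / ε) ^ d ∧
      ∀ x : EuclideanSpace ℝ (Fin d), ‖x‖ ≤ 1 → ∃ y ∈ T, ‖x - y‖ < ε := by
  classical
  -- A separated set of greatest cardinality, which exists by the volume bound, is a net: an
  -- uncovered point could be added to it.
  let Q : ℕ → Prop := fun n => ∃ T : Finset (EuclideanSpace ℝ (Fin d)), (∀ x ∈ T, ‖x‖ ≤ 1) ∧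
    (T : Set (EuclideanSpace ℝ (Fin d))).Pairwise (fun x y => ε ≤ dist x y) ∧ T.card = n
  have hQ0 : Q 0 := ⟨∅, by simp, by simp, rfl⟩
  have hbound : ∀ n, Q n → n ≤ ⌊(1 + 2 / ε) ^ d⌋₊ := by
    rintro _ ⟨T, h1, h2, rfl⟩
    exact Nat.le_floor (card_le_of_pairwise_dist_ge hε T h1 h2)
  obtain ⟨T, hT, hsep, hcard⟩ := Nat.findGreatest_spec (P := Q)
    (Nat.zero_le ⌊(1 + 2 / ε) ^ d⌋₊) hQ0
  refine ⟨T, hT, card_le_of_pairwise_dist_ge hε T hT hsep, fun x hx => ?_⟩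
  by_contra! hcon
  have hxT : x ∉ T := fun h => by
    have := hcon x h
    simp at this
    linarith
  have hQ : Q (T.card + 1) := by
    refine ⟨insert x T, ?_, ?_, Finset.card_insert_of_notMem hxT⟩
    · simpa [hx] using hT
    · rw [Finset.coe_insert]
      refine hsep.insert fun y hy _ => ?_
      rw [dist_comm y x, dist_eq_norm]
      exact ⟨hcon y hy, hcon y hy⟩
  have := Nat.le_findGreatest (hbound _ hQ) hQ
  omega

/-! ### Support functions and Hausdorff distance -/

/-- The support function of the halving polyhedron of a symmetrized point cloud. -/
noncomputable def meanAbs {N : ℕ} {V : Type*} [NormedAddCommGroup V] [InnerProductSpace ℝ V]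
    (p : Fin N → V) (u : V) : ℝ :=
  (N : ℝ)⁻¹ * ∑ i, |inner ℝ (p i) u|

section

variable {N : ℕ} {V : Type*} [NormedAddCommGroup V] [InnerProductSpace ℝ V]

/-- A sum over any subfamily is at most the sum of all positive parts, and the positive parts of a
pair `±p i` add up to `|⟪p i, u⟫|`. -/
lemma inner_le_meanAbs_of_mem (p : Fin N → V) (u : V) {x : V} (hx : x ∈ halvingPolyhedron p) :
    inner ℝ x u ≤ meanAbs p u := by
  have hconv : Convex ℝ {x : V | inner ℝ x u ≤ meanAbs p u} :=
    convex_halfSpace_le ⟨fun a b => inner_add_left a b u,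
      fun c a => by simp [inner_smul_left]⟩ _
  refine convexHull_min ?_ hconv hx
  rintro _ ⟨s, -, rfl⟩
  simp only [Set.mem_ofPred_eq, inner_smul_left, sum_inner, meanAbs, conj_trivial]
  refine mul_le_mul_of_nonneg_left ?_ (by positivity)
  calc ∑ i ∈ s, inner ℝ (symmetrization p i) u
      ≤ ∑ i ∈ s, max (inner ℝ (symmetrization p i) u) 0 :=
        Finset.sum_le_sum fun i _ => le_max_left _ _
    _ ≤ ∑ i, max (inner ℝ (symmetrization p i) u) 0 :=
        Finset.sum_le_sum_of_subset_of_nonneg (Finset.subset_univ _)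
          fun i _ _ => le_max_right _ _
    _ = ∑ i, |inner ℝ (p i) u| := by
        rw [Fintype.sum_sum_type, ← Finset.sum_add_distrib]
        refine Finset.sum_congr rfl fun i _ => ?_
        simp only [symmetrization, Sum.elim_inl, Sum.elim_inr, inner_neg_left]
        rcases le_total 0 (inner ℝ (p i) u) with h | h
        · rw [max_eq_left h, max_eq_right (by linarith), abs_of_nonneg h, add_zero]
        · rw [max_eq_right h, max_eq_left (by linarith), abs_of_nonpos h, zero_add]

lemma exists_mem_halvingPolyhedron_inner_eq (p : Fin N → V) (u : V) :
    ∃ x ∈ halvingPolyhedron p, inner ℝ x u = meanAbs p u := by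
  classical
  -- One member of each pair, with the favourable sign, gives exactly `N` labels.
  let c : Fin N → Fin N ⊕ Fin N := fun i =>
    if 0 ≤ inner ℝ (p i) u then Sum.inl i else Sum.inr i
  have hc : Function.Injective c := by
    intro i j hij
    simp only [c] at hij
    split_ifs at hij <;> simp_all
  refine ⟨(N : ℝ)⁻¹ • ∑ i ∈ Finset.univ.image c, symmetrization p i,
    subset_convexHull ℝ _ ⟨_, ?_, rfl⟩, ?_⟩
  · rw [Finset.card_image_of_injective _ hc, Finset.card_univ, Fintype.card_fin]
  · rw [Finset.sum_image (fun a _ b _ h => hc h), inner_smul_left, sum_inner, meanAbs,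
      conj_trivial]
    congr 1
    refine Finset.sum_congr rfl fun i _ => ?_
    simp only [c]
    split_ifs with h
    · simp [symmetrization, abs_of_nonneg h]
    · simp [symmetrization, abs_of_neg (not_le.1 h)]

lemma isCompact_halvingPolyhedron (p : Fin N → V) : IsCompact (halvingPolyhedron p) := by
  refine Set.Finite.isCompact_convexHull ℝ ((Set.finite_range
    fun s : Finset (Fin N ⊕ Fin N) => (N : ℝ)⁻¹ • ∑ i ∈ s, symmetrization p i).subset ?_)
  rintro _ ⟨s, -, rfl⟩
  exact ⟨s, rfl⟩

lemma nonempty_halvingPolyhedron (p : Fin N → V) : (halvingPolyhedron p).Nonempty :=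
  let ⟨x, hx, _⟩ := exists_mem_halvingPolyhedron_inner_eq p 0
  ⟨x, hx⟩

/-- A nonempty compact convex set whose support function is within `η` of `1` on the unit sphere
is within Hausdorff distance `η` of the unit ball. -/
lemma hausdorffDist_closedBall_le {K : Set V} (hne : K.Nonempty) (hK : IsCompact K)
    (hconv : Convex ℝ K) {η : ℝ} (hη : 0 ≤ η)
    (hle : ∀ u : V, ‖u‖ = 1 → ∀ x ∈ K, inner ℝ x u ≤ 1 + η)
    (hge : ∀ u : V, ‖u‖ = 1 → ∃ x ∈ K, 1 - η ≤ inner ℝ x u) :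
    Metric.hausdorffDist K (Metric.closedBall 0 1) ≤ η := by
  refine Metric.hausdorffDist_le_of_mem_dist hη (fun x hx => ?_) (fun y hy => ?_)
  · rcases le_or_gt ‖x‖ 1 with h | h
    · exact ⟨x, by simpa using h, by simpa using hη⟩
    · have h0 : 0 < ‖x‖ := one_pos.trans h
      have hx1 : ‖x‖ ≤ 1 + η := by
        have := hle (‖x‖⁻¹ • x) (by rw [norm_smul, norm_inv, norm_norm]; field_simp) x hx
        rw [inner_smul_right, real_inner_self_eq_norm_sq] at this
        calc ‖x‖ = ‖x‖⁻¹ * ‖x‖ ^ 2 := by field_simp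
          _ ≤ _ := this
      refine ⟨‖x‖⁻¹ • x, ?_, ?_⟩
      · rw [mem_closedBall_zero_iff, norm_smul, norm_inv, norm_norm]
        field_simp
        exact le_rfl
      · rw [dist_eq_norm]
        have : x - ‖x‖⁻¹ • x = (1 - ‖x‖⁻¹) • x := by module
        rw [this, norm_smul, Real.norm_of_nonneg (by linarith [inv_le_one_of_one_le₀ h.le]),
          sub_mul, inv_mul_cancel₀ h0.ne']
        linarith
  -- For `z` nearest to `y` in `K` and `u` the direction of `y - z`, the support value at `u` is
  -- `⟪z, u⟫ = ⟪y, u⟫ - ‖y - z‖ ≤ 1 - ‖y - z‖`, while it is at least `1 - η`.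
  · obtain ⟨z, hz, hmin⟩ := exists_norm_eq_iInf_of_complete_convex hne hK.isComplete hconv y
    refine ⟨z, hz, ?_⟩
    rw [norm_eq_iInf_iff_real_inner_le_zero hconv hz] at hmin
    rw [dist_eq_norm]
    by_cases h0 : y - z = 0
    · rw [h0, norm_zero]
      exact hη
    have hn : 0 < ‖y - z‖ := norm_pos_iff.2 h0
    obtain ⟨x, hx, hxu⟩ := hge (‖y - z‖⁻¹ • (y - z))
      (by rw [norm_smul, norm_inv, norm_norm]; field_simp)
    have h1 := hmin x hx
    have hy1 : ‖y‖ ≤ 1 := by simpa using hy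
    have h2 : inner ℝ y (y - z) ≤ ‖y - z‖ :=
      (real_inner_le_norm _ _).trans (mul_le_of_le_one_left hn.le hy1)
    have h3 : ‖y - z‖ ^ 2 = inner ℝ y (y - z) - inner ℝ z (y - z) := by
      rw [← inner_sub_left, real_inner_self_eq_norm_sq]
    rw [real_inner_comm, inner_sub_left] at h1
    rw [inner_smul_right, inv_mul_eq_div, le_div_iff₀ hn] at hxu
    nlinarith

lemma hausdorffDist_halvingPolyhedron_le (p : Fin N → V) {m η : ℝ} (hm : 0 < m) (hη : 0 ≤ η)
    (h : ∀ u : V, ‖u‖ = 1 → |meanAbs p u - m| ≤ η * m) :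
    Metric.hausdorffDist (m⁻¹ • halvingPolyhedron p) (Metric.closedBall 0 1) ≤ η := by
  refine hausdorffDist_closedBall_le ((nonempty_halvingPolyhedron p).smul_set)
    ((isCompact_halvingPolyhedron p).smul _) ((convex_convexHull ℝ _).smul _) hη ?_ ?_
  · rintro u hu _ ⟨x, hx, rfl⟩
    have h1 := inner_le_meanAbs_of_mem p u hx
    have h2 := (abs_le.1 (h u hu)).2
    simp only [inner_smul_left, conj_trivial]
    rw [inv_mul_le_iff₀ hm]
    linarith
  · intro u hu
    obtain ⟨x, hx, hxu⟩ := exists_mem_halvingPolyhedron_inner_eq p u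
    refine ⟨m⁻¹ • x, Set.smul_mem_smul_set hx, ?_⟩
    have h2 := (abs_le.1 (h u hu)).1
    simp only [inner_smul_left, conj_trivial]
    rw [le_inv_mul_iff₀ hm, hxu]
    linarith

end

/-! ### From two nets to the whole sphere -/

section

variable {N : ℕ} {V : Type*} [NormedAddCommGroup V] [InnerProductSpace ℝ V]

lemma meanAbs_zero (p : Fin N → V) : meanAbs p 0 = 0 := by simp [meanAbs]

lemma meanAbs_smul (p : Fin N → V) (c : ℝ) (u : V) : meanAbs p (c • u) = |c| * meanAbs p u := by
  simp only [meanAbs, inner_smul_right, abs_mul, ← Finset.mul_sum]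
  ring

lemma abs_meanAbs_sub_le (p : Fin N → V) (u v : V) :
    |meanAbs p u - meanAbs p v| ≤ meanAbs p (u - v) := by
  simp only [meanAbs]
  rw [← mul_sub, ← Finset.sum_sub_distrib, abs_mul, abs_of_nonneg (by positivity : 0 ≤ (N : ℝ)⁻¹)]
  gcongr
  refine (Finset.abs_sum_le_sum_abs _ _).trans (Finset.sum_le_sum fun i _ => ?_)
  rw [inner_sub_right]
  exact abs_abs_sub_abs_le _ _

lemma continuous_meanAbs (p : Fin N → V) : Continuous (meanAbs p) := by
  unfold meanAbs
  fun_prop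

/-- Control of the deviation of `meanAbs` from a multiple of the norm on the unit sphere, from its
control on a coarse net `S` and that of the increments between `S` and a fine net `T`. -/
lemma abs_meanAbs_sub_le_of_nets [FiniteDimensional ℝ V] (p : Fin N → V) {m η ε δ : ℝ}
    (hm : 0 < m) (hη : 0 < η) (hδ : δ ≤ 1 / 2) (hεη : ε * (3 + η / 2) ≤ η / 2)
    {S T : Finset V} {π : V → V} (hS1 : ∀ x ∈ S, ‖x‖ ≤ 1) (hT1 : ∀ x ∈ T, ‖x‖ ≤ 1)
    (hπ : ∀ x, ‖x‖ ≤ 1 → π x ∈ S) (hπδ : ∀ x, ‖x‖ ≤ 1 → ‖x - π x‖ < δ)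
    (hT : ∀ x, ‖x‖ ≤ 1 → ∃ y ∈ T, ‖x - y‖ < ε)
    (hS : ∀ v ∈ S, |meanAbs p v - m * ‖v‖| < η * m / 4)
    (hST : ∀ v ∈ T, |meanAbs p v - meanAbs p (π v) - m * (‖v‖ - ‖π v‖)| < η * m / 4)
    (u : V) (hu : ‖u‖ = 1) : |meanAbs p u - m| ≤ η * m := by
  obtain ⟨u₀, hu₀, hmax⟩ := (isCompact_sphere (0 : V) 1).exists_isMaxOn ⟨u, by simpa using hu⟩
    (continuous_meanAbs p).continuousOn
  rw [mem_sphere_zero_iff_norm] at hu₀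
  set M := meanAbs p u₀ with hM
  have hMle : ∀ w, meanAbs p w ≤ M * ‖w‖ := by
    intro w
    by_cases hw : w = 0
    · simp [hw, meanAbs_zero]
    have hn : 0 < ‖w‖ := norm_pos_iff.2 hw
    have h1 : meanAbs p (‖w‖⁻¹ • w) ≤ M := hmax (by
      rw [mem_sphere_zero_iff_norm, norm_smul, norm_inv, norm_norm, inv_mul_cancel₀ hn.ne'])
    rwa [meanAbs_smul, abs_of_pos (inv_pos.2 hn), inv_mul_le_iff₀ hn, mul_comm] at h1
  have hM0 : 0 ≤ M := by
    rw [hM, meanAbs]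
    positivity
  -- Approximating the maximizer by a coarse point gives `M ≤ m * (1 + η / 4) + M / 2`; the last
  -- term is absorbed on the left.
  have hM2 : M ≤ 2 * (m * (1 + η / 4)) := by
    have h1 := hS _ (hπ u₀ hu₀.le)
    have h2 := hS1 _ (hπ u₀ hu₀.le)
    have h3 := (le_abs_self _).trans (abs_meanAbs_sub_le p u₀ (π u₀))
    have h4 := hMle (u₀ - π u₀)
    have h5 : M * ‖u₀ - π u₀‖ ≤ M * (1 / 2) :=
      mul_le_mul_of_nonneg_left ((hπδ u₀ hu₀.le).le.trans hδ) hM0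
    have h6 : m * ‖π u₀‖ ≤ m * 1 := by gcongr
    have h7 := (abs_lt.1 h1).2
    linarith
  obtain ⟨v, hv, huv⟩ := hT u hu.le
  have h1 := hST v hv
  have h2 := hS _ (hπ v (hT1 v hv))
  have h3 := (abs_meanAbs_sub_le p u v).trans (hMle (u - v))
  have h4 : |m * (‖u‖ - ‖v‖)| ≤ m * ‖u - v‖ := by
    rw [abs_mul, abs_of_pos hm]
    gcongr
    exact abs_norm_sub_norm_le u v
  -- Error budget: `η * m / 4` from each net event, and `η * m / 2` from moving `u` to the fine
  -- point `v`.
  have h5 : (M + m) * ‖u - v‖ ≤ (m * (3 + η / 2)) * ε := by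
    have : 0 < ε := (norm_nonneg _).trans_lt huv
    refine mul_le_mul (by linarith) huv.le (norm_nonneg _) (by positivity)
  have h6 : (m * (3 + η / 2)) * ε ≤ m * (η / 2) := by
    have := mul_le_mul_of_nonneg_left hεη hm.le
    linarith
  rw [hu] at h4
  have ⟨a1, b1⟩ := abs_lt.1 h1
  have ⟨a2, b2⟩ := abs_lt.1 h2
  have ⟨a3, b3⟩ := abs_le.1 h3
  have ⟨a4, b4⟩ := abs_le.1 h4
  rw [abs_le]
  constructor <;> linarith

end

/-! ### Concentration and the union bound -/

/-- The increments of the random function `meanAbs` have subgaussian tails. -/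
lemma measureReal_abs_meanAbs_increment_ge_le {d N : ℕ} (hd : 1 ≤ d) (hN : 1 ≤ N) {Ω : Type*}
    [MeasurableSpace Ω] {P : Measure Ω} [IsProbabilityMeasure P] {X : Fin N → Ω → UnitSphere d}
    (hX : ∀ i, HasLaw (X i) (uniformSphere d) P) (hind : iIndepFun X P) (u : UnitSphere d)
    (v w : EuclideanSpace ℝ (Fin d)) {ρ t : ℝ} (ht : 0 ≤ t) (hρ : ‖v - w‖ ≤ ρ) :
    P.real {ω | t ≤ |meanAbs (fun i => (X i ω : EuclideanSpace ℝ (Fin d))) v -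
        meanAbs (fun i => (X i ω : EuclideanSpace ℝ (Fin d))) w -
        meanAbsInner u * (‖v‖ - ‖w‖)|} ≤
      2 * Real.exp (-(N * t ^ 2 * d / (8 * ρ ^ 2))) := by
  have := isProbabilityMeasure_uniformSphere hd
  have hN0 : (0 : ℝ) < N := by exact_mod_cast hN
  have hd0 : (0 : ℝ) < d := by exact_mod_cast hd
  have hρ0 : 0 ≤ ρ := (norm_nonneg _).trans hρ
  set Y : UnitSphere d → ℝ := fun x =>
    |inner ℝ (x : EuclideanSpace ℝ (Fin d)) v| - |inner ℝ (x : EuclideanSpace ℝ (Fin d)) w| with hY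
  have hYc : Continuous Y := by fun_prop
  have hYint : ∫ x, Y x ∂(uniformSphere d) = meanAbsInner u * (‖v‖ - ‖w‖) := by
    rw [hY, integral_sub (integrable_uniformSphere_of_continuous (by fun_prop))
      (integrable_uniformSphere_of_continuous (by fun_prop)),
      integral_abs_inner_uniformSphere u, integral_abs_inner_uniformSphere u]
    ring
  set Z : UnitSphere d → ℝ := fun x => Y x - meanAbsInner u * (‖v‖ - ‖w‖) with hZ
  have hZc : Continuous Z := by fun_prop
  have hsub : HasSubgaussianMGF Z (4 * ρ.toNNReal ^ 2 / d) (uniformSphere d) := by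
    have h := hasSubgaussianMGF_uniformSphere hd (v - w) hYc (fun x => by
      rw [inner_sub_right]
      exact abs_abs_sub_abs_le _ _)
    rw [hYint] at h
    refine ⟨h.integrable_exp_mul, fun s => (h.mgf_le s).trans (Real.exp_le_exp.2 ?_)⟩
    push_cast
    rw [Real.coe_toNNReal _ hρ0]
    gcongr
  have hsubX : ∀ i, HasSubgaussianMGF (fun ω => Z (X i ω)) (4 * ρ.toNNReal ^ 2 / d) P := fun i =>
    HasSubgaussianMGF.of_map (X := Z) (hX i).aemeasurable (by rwa [(hX i).map_eq])
  have hindZ : iIndepFun (fun i ω => Z (X i ω)) P :=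
    hind.comp (fun _ => Z) (fun _ => hZc.measurable)
  have hindZ' : iIndepFun (fun i ω => -Z (X i ω)) P :=
    hind.comp (fun _ x => -Z x) (fun _ => hZc.neg.measurable)
  have hNt : 0 ≤ N * t := by positivity
  have h1 := HasSubgaussianMGF.measure_sum_ge_le_of_iIndepFun hindZ (s := Finset.univ)
    (fun i _ => hsubX i) hNt
  have h2 := HasSubgaussianMGF.measure_sum_ge_le_of_iIndepFun hindZ' (s := Finset.univ)
    (fun i _ => (hsubX i).neg) hNt
  have hexp : -(N * t) ^ 2 / (2 * ((∑ _ : Fin N, 4 * ρ.toNNReal ^ 2 / d : NNReal) : ℝ)) =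
      -(N * t ^ 2 * d / (8 * ρ ^ 2)) := by
    simp only [Finset.sum_const, Finset.card_univ, Fintype.card_fin, nsmul_eq_mul]
    push_cast
    rw [Real.coe_toNNReal _ hρ0]
    -- For `ρ = 0` both exponents are zero, by division by zero.
    rcases hρ0.eq_or_lt with rfl | h0
    · simp
    · field_simp
      ring
  rw [hexp] at h1 h2
  have hsum : ∀ ω, ∑ i, Z (X i ω) = N * (meanAbs (fun i => (X i ω : EuclideanSpace ℝ (Fin d))) v -
      meanAbs (fun i => (X i ω : EuclideanSpace ℝ (Fin d))) w -
      meanAbsInner u * (‖v‖ - ‖w‖)) := by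
    intro ω
    simp only [hZ, hY, meanAbs, Finset.sum_sub_distrib, Finset.sum_const, Finset.card_univ,
      Fintype.card_fin, nsmul_eq_mul]
    field_simp
  calc _ ≤ P.real ({ω | N * t ≤ ∑ i, Z (X i ω)} ∪ {ω | N * t ≤ ∑ i, -Z (X i ω)}) := by
        refine measureReal_mono fun ω hω => ?_
        simp only [Set.mem_union, Set.mem_ofPred_eq, Finset.sum_neg_distrib, hsum] at hω ⊢
        rw [← mul_neg, mul_le_mul_iff_right₀ hN0, mul_le_mul_iff_right₀ hN0]
        exact le_abs.1 hω
    _ ≤ _ := measureReal_union_le _ _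
    _ ≤ _ := by linarith

/-- Union bound over `A ^ d` points with two-sided tails: the factor `1 / 4` absorbs the two tails
and leaves half of the allowed failure probability. -/
lemma mul_pow_mul_exp_le {A x κ : ℝ} {d : ℕ} (hd : 1 ≤ d) (hA : 0 ≤ A)
    (h : A * Real.exp (-x) ≤ Real.exp (-κ) / 4) :
    A ^ d * (2 * Real.exp (-(d * x))) ≤ Real.exp (-κ * d) / 2 := by
  have h1 : (A * Real.exp (-x)) ^ d ≤ (Real.exp (-κ) / 4) ^ d := by gcongr
  have h4 : (4 : ℝ) ≤ 4 ^ d := le_self_pow₀ (by norm_num) (by omega)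
  rw [mul_pow, div_pow, ← Real.exp_nat_mul, ← Real.exp_nat_mul] at h1
  have h2 : Real.exp (d * -κ) / 4 ^ d ≤ Real.exp (d * -κ) / 4 := by gcongr
  rw [show (d : ℝ) * -x = -(d * x) by ring] at h1
  rw [show (d : ℝ) * -κ = -κ * d by ring] at h1 h2
  linarith

theorem corollary1 (κ : ℝ) (hκ : 0 < κ) :
    ∃ C : ℝ, ∀ (η : ℝ) (d N : ℕ), 0 < η → 1 / η ^ 2 ≤ (d : ℝ) →
      (d : ℝ) / η ^ 2 * (Real.log d + C) ≤ (N : ℝ) →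
      ∀ (Ω : Type*) [MeasurableSpace Ω] (P : Measure Ω) [IsProbabilityMeasure P]
        (X : Fin N → Ω → UnitSphere d),
        (∀ i, HasLaw (X i) (uniformSphere d) P) → iIndepFun X P →
        ∀ u : UnitSphere d,
          1 - Real.exp (-κ * d) ≤
            P.real {ω | Metric.hausdorffDist
              ((meanAbsInner u)⁻¹ •
                halvingPolyhedron (fun i => (X i ω : EuclideanSpace ℝ (Fin d))))
              (Metric.closedBall (0 : EuclideanSpace ℝ (Fin d)) 1) ≤ η} := by
  set L : ℝ := Real.log 513 + κ + Real.log 4 with hL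
  have hL0 : 0 < L := by
    have := Real.log_pos (show (1 : ℝ) < 513 by norm_num)
    have := Real.log_pos (show (1 : ℝ) < 4 by norm_num)
    linarith
  have hexpL : 513 * Real.exp (-L) = Real.exp (-κ) / 4 := by
    rw [hL, show -(Real.log 513 + κ + Real.log 4) = -κ - Real.log 513 - Real.log 4 by ring,
      Real.exp_sub, Real.exp_sub, Real.exp_log (by norm_num), Real.exp_log (by norm_num)]
    ring
  -- `40960 = 320 * 128`: the loss from the bound on `m²` times the denominator of the coarse
  -- exponent.
  refine ⟨40960 * L, fun η d N hη hdη hN Ω _ P _ X hX hind u => ?_⟩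
  have hd0 : (0 : ℝ) < d := lt_of_lt_of_le (by positivity) hdη
  have hd : 1 ≤ d := by exact_mod_cast hd0
  have hd1 : (1 : ℝ) ≤ d := by exact_mod_cast hd
  have hlog : 0 ≤ Real.log d := Real.log_nonneg hd1
  have hN0 : (0 : ℝ) < N := lt_of_lt_of_le (by positivity) hN
  have hN1 : 1 ≤ N := by exact_mod_cast hN0
  have hNη : d * (Real.log d + 40960 * L) ≤ N * η ^ 2 := by
    rw [div_mul_eq_mul_div, div_le_iff₀ (by positivity)] at hN
    exact hN
  set m := meanAbsInner u with hm
  have hm0 : 0 < m := meanAbsInner_pos hd u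
  have hm2 : 1 ≤ 320 * d * m ^ 2 := by
    have := meanAbsInner_sq_ge hd u
    rw [div_le_iff₀ (by positivity)] at this
    linarith
  have hNm : N * η ^ 2 ≤ 320 * (N * η ^ 2 * m ^ 2 * d) := by
    have := mul_le_mul_of_nonneg_left hm2 (show 0 ≤ N * η ^ 2 by positivity)
    linarith
  -- The mesh satisfies `ε * (3 + η / 2) ≤ 7 * η / 16 ≤ η / 2`.
  set ε : ℝ := min η 1 / 8 with hε
  have hmin : 0 < min η 1 := lt_min hη one_pos
  have hε0 : 0 < ε := by positivity
  -- The mesh `1 / 256` gives `1 + 2 * 256 = 513` in the cardinality bound, and makes the fine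
  -- exponent `512 * N η² m² d`, which exceeds the loss factor `320`.
  obtain ⟨S, hS1, hScard, hS⟩ := exists_finset_net (d := d) (show (0 : ℝ) < 1 / 256 by norm_num)
  obtain ⟨T, hT1, hTcard, hT⟩ := exists_finset_net (d := d) hε0
  have hπ' : ∀ x : EuclideanSpace ℝ (Fin d), ∃ y, ‖x‖ ≤ 1 → y ∈ S ∧ ‖x - y‖ < 1 / 256 := by
    intro x
    by_cases hx : ‖x‖ ≤ 1
    · obtain ⟨y, hy⟩ := hS x hx
      exact ⟨y, fun _ => hy⟩
    · exact ⟨0, fun h => absurd h hx⟩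
  choose π hπ using hπ'
  let F : Ω → EuclideanSpace ℝ (Fin d) → ℝ := fun ω =>
    meanAbs (fun i => (X i ω : EuclideanSpace ℝ (Fin d)))
  let A : EuclideanSpace ℝ (Fin d) → EuclideanSpace ℝ (Fin d) → Set Ω := fun v w =>
    {ω | η * m / 4 ≤ |F ω v - F ω w - m * (‖v‖ - ‖w‖)|}
  have hA : ∀ (v w : EuclideanSpace ℝ (Fin d)) (ρ : ℝ), ‖v - w‖ ≤ ρ →
      P.real (A v w) ≤ 2 * Real.exp (-(N * (η * m / 4) ^ 2 * d / (8 * ρ ^ 2))) :=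
    fun v w ρ h => measureReal_abs_meanAbs_increment_ge_le hd hN1 hX hind u v w
      (by positivity) h
  have hcoarse : P.real (⋃ v ∈ S, A v 0) ≤ Real.exp (-κ * d) / 2 := by
    have h1 : ∀ v ∈ S, P.real (A v 0) ≤ 2 * Real.exp (-(d * L)) := by
      intro v hv
      refine (hA v 0 1 (by simpa using hS1 v hv)).trans ?_
      gcongr
      have : 0 ≤ d * Real.log d := by positivity
      have : N * (η * m / 4) ^ 2 * d / (8 * 1 ^ 2) = N * η ^ 2 * m ^ 2 * d / 128 := by ring
      linarith
    calc P.real (⋃ v ∈ S, A v 0) ≤ ∑ v ∈ S, P.real (A v 0) := measureReal_biUnion_finset_le _ _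
      _ ≤ S.card * (2 * Real.exp (-(d * L))) := by
        rw [← nsmul_eq_mul]
        exact Finset.sum_le_card_nsmul _ _ _ h1
      _ ≤ 513 ^ d * (2 * Real.exp (-(d * L))) := by
        gcongr
        refine hScard.trans (le_of_eq ?_)
        norm_num
      _ ≤ _ := mul_pow_mul_exp_le hd (by norm_num) hexpL.le
  have hfine : P.real (⋃ v ∈ T, A v (π v)) ≤ Real.exp (-κ * d) / 2 := by
    have h1 : ∀ v ∈ T, P.real (A v (π v)) ≤ 2 * Real.exp (-(d * (Real.log d + L))) := by
      intro v hv
      refine (hA v (π v) (1 / 256) (hπ v (hT1 v hv)).2.le).trans ?_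
      gcongr
      have : N * (η * m / 4) ^ 2 * d / (8 * (1 / 256) ^ 2) = 512 * (N * η ^ 2 * m ^ 2 * d) := by
        ring
      have : d * (Real.log d + L) ≤ d * (Real.log d + 40960 * L) := by
        gcongr
        linarith
      have : 0 ≤ N * η ^ 2 * m ^ 2 * d := by positivity
      linarith
    -- The hypothesis `d ≥ 1 / η²` enters here: it bounds the inverse mesh by a multiple of `d`, so
    -- that `log d` suffices in place of `log (1 / η)`.
    have hbase : 1 + 2 / ε ≤ 17 * d := by
      have h2 : 1 ≤ d * min η 1 := by
        rcases min_cases η 1 with ⟨h, h'⟩ | ⟨h, -⟩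
        · rw [h]
          rw [div_le_iff₀ (by positivity)] at hdη
          nlinarith
        · rw [h]
          linarith
      have h3 : 2 / ε ≤ 16 * d := by
        rw [div_le_iff₀ hε0, hε]
        linarith
      linarith
    have hexp : 17 * (d : ℝ) * Real.exp (-(Real.log d + L)) ≤ Real.exp (-κ) / 4 := by
      rw [neg_add, Real.exp_add, Real.exp_neg, Real.exp_log hd0, ← hexpL]
      have := Real.exp_pos (-L)
      field_simp
      linarith
    calc P.real (⋃ v ∈ T, A v (π v)) ≤ ∑ v ∈ T, P.real (A v (π v)) :=
          measureReal_biUnion_finset_le _ _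
      _ ≤ T.card * (2 * Real.exp (-(d * (Real.log d + L)))) := by
        rw [← nsmul_eq_mul]
        exact Finset.sum_le_card_nsmul _ _ _ h1
      _ ≤ (17 * d) ^ d * (2 * Real.exp (-(d * (Real.log d + L)))) := by
        gcongr
        exact hTcard.trans (by gcongr)
      _ ≤ _ := mul_pow_mul_exp_le hd (by positivity) hexp
  set G := {ω | Metric.hausdorffDist
    (m⁻¹ • halvingPolyhedron (fun i => (X i ω : EuclideanSpace ℝ (Fin d))))
    (Metric.closedBall (0 : EuclideanSpace ℝ (Fin d)) 1) ≤ η} with hG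
  -- Covering the whole space and using subadditivity avoids proving that `G` is measurable.
  have hcover : Set.univ ⊆ G ∪ ((⋃ v ∈ S, A v 0) ∪ ⋃ v ∈ T, A v (π v)) := by
    intro ω _
    by_cases hω : ω ∈ (⋃ v ∈ S, A v 0) ∪ ⋃ v ∈ T, A v (π v)
    · exact Or.inr hω
    left
    simp only [A, Set.mem_union, Set.mem_iUnion, Set.mem_ofPred_eq, not_or, not_exists,
      not_le] at hω
    refine hausdorffDist_halvingPolyhedron_le _ hm0 hη.le
      (abs_meanAbs_sub_le_of_nets _ hm0 hη (δ := 1 / 256) (ε := ε) (by norm_num) ?_ hS1 hT1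
        (fun x hx => (hπ x hx).1) (fun x hx => (hπ x hx).2) hT (fun v hv => ?_)
        (fun v hv => hω.2 v hv))
    · have h1 : min η 1 ≤ η := min_le_left _ _
      have h2 : min η 1 * η ≤ 1 * η := by
        gcongr
        exact min_le_right _ _
      rw [hε]
      linarith
    · have := hω.1 v hv
      simpa [F, meanAbs_zero] using this
  have hone : 1 ≤ P.real (G ∪ ((⋃ v ∈ S, A v 0) ∪ ⋃ v ∈ T, A v (π v))) := by
    have := measureReal_mono (μ := P) hcover
    simpa using this
  have h2 := measureReal_union_le (μ := P) G ((⋃ v ∈ S, A v 0) ∪ ⋃ v ∈ T, A v (π v))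
  have h3 := measureReal_union_le (μ := P) (⋃ v ∈ S, A v 0) (⋃ v ∈ T, A v (π v))
  linarith
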